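/- Setting. Let $\mathcal M$ be an MDP with (possibly infinite) state space $\mathcal X$, finite action set $\mathcal A$, horizon $H\in\mathbb N$, transition kernel $P:\mathcal X\times\mathcal A\to\Delta(\mathcal X)$, initial distribution $\rho_{\mathrm{init}}$ and reward function $R:\mathcal X\times\mathcal A\to[0,1]$. It is layered: $\mathcal X$ is the disjoint union of (measurable) layers $\mathcal X_1,\dots,\mathcal X_H$, $\rho_{\mathrm{init}}(\mathcal X_1)=1$, and $P(\mathcal X_{h+1}\mid x,a)=1$ for $x\in\mathcal X_h$, $h<H$, $a\in\mathcal A$. Let $\Pi$ be the set of all (measurable) policies $\pi:\mathcal X\to\Delta(\mathcal A)$. For $\pi\in\Pi$, $h\in[H]$ and $(x,a)\in\mathcal X_h\times\mathcal A$, let $\mathbb E^\pi[\,\cdot\mid x_h=x,a_h=a]$ be the expectation for the process started at step $h$ from $(x,a)$ and continued by $x_{k+1}\sim P(\cdot\mid x_k,a_k)$, $a_{k+1}\sim\pi(x_{k+1})$, and let $Q_h^\pi(x,a)=\mathbb E^\pi[\sum_{k=h}^H R(x_k,a_k)\mid x_h=x,a_h=a]$. Assume linear $Q^\pi$-realizability: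 there are a feature map $\phi:\mathcal X\times\mathcal A\to\mathbb R^d$ with $\|\phi(x,a)\|\le 1$ and vectors $\theta_h^\pi\in\mathbb R^d$ with $\|\theta_h^\pi\|\le H$ such that $Q_h^\pi(x,a)=\phi(x,a)^\top\theta_h^\pi$ for all $h\in[H]$, $\pi\in\Pi$, $(x,a)\in\mathcal X_h\times\mathcal A$. Put $\tilde d=4d\log\log d+16$ (where $d\log\log d$ is read as $0$ if $d\le 1$). For each $h\in[H]$ let $\rho_h$ be a finitely supported probability distribution on $\Pi$ with $|\mathrm{supp}\,\rho_h|\le\tilde d$ that is an approximate optimal design for $\{\theta_h^\pi\mid\pi\in\Pi\}$, i.e. $(\theta_h^\pi)^\top G_h^\dagger\,\theta_h^\pi\le 2d$ for all $\pi\in\Pi$, where $G_h=\sum_{\pi\in\mathrm{supp}\,\rho_h}\rho_h(\pi)\,\theta_h^\pi(\theta_h^\pi)^\top$ and $\dagger$ is the Moore–Penrose pseudo-inverse. The design range of $x\in\mathcal X_h$ is $$\mathrm{Rg}^{\mathtt D}(x)=\max_{a,a'\in\mathcal A}\ \max_{\pi\in\mathrm{supp}\,\rho_h}\ \langle\phi(x,a)-\phi(x,a'),\theta_h^\pi\rangle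 .$$ Lemma (skip-step admissible realizability). Let $\ell\in[H]$, $L>0$, $\gamma>0$ and a (measurable) $f:\mathcal X_\ell\to[-L,L]$ be given. Then for every $h\in\{1,\dots,\ell-1\}$ and every $\pi\in\Pi$ there exists $\theta\in\mathbb R^d$ with $$\|\theta\|\le\frac{4\,\tilde d\,H^2L}{\gamma}$$ such that for all $(x,a)\in\mathcal X_h\times\mathcal A$ the following expectation exists (its integrand is integrable) and $$\mathbb E^\pi\Big[\mathbb I\{\mathrm{Rg}^{\mathtt D}(x_\ell)\ge\gamma\}\prod_{k=h+1}^{\ell-1}\mathbb I\{\mathrm{Rg}^{\mathtt D}(x_k)<\gamma\}\cdot f(x_\ell)\ \Big|\ x_h=x,\ a_h=a\Big]=\phi(x,a)^\top\theta .$$ -/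

import Mathlib

open MeasureTheory ProbabilityTheory
open scoped RealInnerProductSpace

noncomputable section

/-- A finite-horizon layered Markov decision process with state space `X`, finite action set `A`,
horizon `H`, transition kernel `P`, initial law `init` and reward function `R` with values in
`[0, 1]`. The state space is the disjoint union of the layers `{x | layerOf x = h}`, `1 ≤ h ≤ H`;
the process starts in layer `1` and moves from layer `h` to layer `h + 1`. (What `P` does at
states of layer `H` is irrelevant: no reward is collected after step `H`.) -/
structure LayeredMDP (X A : Type*) [MeasurableSpace X] [MeasurableSpace A] where
  H : ℕ
  P : Kernel (X × A) X
  markov_P : IsMarkovKernel P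
  init : Measure X
  prob_init : IsProbabilityMeasure init
  R : X → A → ℝ
  measurable_R : Measurable (Function.uncurry R)
  R_mem : ∀ x a, R x a ∈ Set.Icc (0 : ℝ) 1
  layerOf : X → ℕ
  measurable_layerOf : Measurable layerOf
  layerOf_mem : ∀ x, layerOf x ∈ Finset.Icc 1 H
  init_layer : ∀ᵐ x ∂init, layerOf x = 1
  P_layer : ∀ x a, layerOf x < H → ∀ᵐ y ∂(P (x, a)), layerOf y = layerOf x + 1

/-- A Markovian randomized policy: a (measurable) map from states to distributions on actions. -/
structure Policy (X A : Type*) [MeasurableSpace X] [MeasurableSpace A] where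
  act : Kernel X A
  markov_act : IsMarkovKernel act

attribute [instance] LayeredMDP.markov_P LayeredMDP.prob_init Policy.markov_act

namespace LayeredMDP

variable {X A : Type*} [MeasurableSpace X] [MeasurableSpace A]

/-- The set of states of layer `h`. -/
def layer (M : LayeredMDP X A) (h : ℕ) : Set X := {x | M.layerOf x = h}

/-- One step of the state-action process: from `(x, a)`, draw `x' ∼ P(x, a)`, then
`a' ∼ π(x')`. -/
def step (M : LayeredMDP X A) (π : Policy X A) : Kernel (X × A) (X × A) :=
  M.P ⊗ₖ Kernel.prodMkLeft (X × A) π.act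

instance (M : LayeredMDP X A) (π : Policy X A) : IsMarkovKernel (M.step π) := by
  unfold step; infer_instance

/-- The law of the state-action pair at time `n + 1` given the history up to time `n`; by the
Markov property it depends on the last pair only. -/
def histStep (M : LayeredMDP X A) (π : Policy X A) (n : ℕ) :
    Kernel (Finset.Iic n → X × A) (X × A) :=
  (M.step π).comap (fun w => w ⟨n, Finset.mem_Iic.2 le_rfl⟩) (measurable_pi_apply _)

instance (M : LayeredMDP X A) (π : Policy X A) (n : ℕ) : IsMarkovKernel (M.histStep π n) := by
  unfold histStep; infer_instance

/-- The law of the trajectory `k ↦ (x_k, a_k)`, `k ≥ h`, of the process run under `π`, given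
`x_h = x` and `a_h = a`. (The coordinates with index `k < h` carry no information; they are set
to `(x, a)`.) -/
def condLaw (M : LayeredMDP X A) (π : Policy X A) (h : ℕ) (x : X) (a : A) :
    Measure (ℕ → X × A) :=
  Kernel.traj (X := fun _ => X × A) (M.histStep π) h (fun _ => (x, a))

/-- The state-action value function `Q_h^π(x, a) = E^π[∑_{k=h}^H r_k | x_h = x, a_h = a]`. -/
def Q (M : LayeredMDP X A) (π : Policy X A) (h : ℕ) (x : X) (a : A) : ℝ :=
  ∫ ω, ∑ k ∈ Finset.Icc h M.H, M.R (ω k).1 (ω k).2 ∂(M.condLaw π h x a)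

/-- Linear `Q^π`-realizability with feature map `φ`, where `θ h π` is the parameter
of the value function of `π` at layer `h`. -/
structure IsLinearlyRealizable (M : LayeredMDP X A) {d : ℕ}
    (φ : X → A → EuclideanSpace ℝ (Fin d))
    (θ : ℕ → Policy X A → EuclideanSpace ℝ (Fin d)) : Prop where
  norm_feature_le : ∀ x a, ‖φ x a‖ ≤ 1
  norm_param_le : ∀ h ∈ Finset.Icc 1 M.H, ∀ π, ‖θ h π‖ ≤ M.H
  Q_eq : ∀ h ∈ Finset.Icc 1 M.H, ∀ π, ∀ x ∈ M.layer h, ∀ a, M.Q π h x a = ⟪φ x a, θ h π⟫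

/-- The design range of a state `x`, with respect to the finitely supported weights `ρ h` on
policies, `h = 1, …, H`: the largest value of `⟨φ(x, a) - φ(x, a'), θ_h^π⟩` over actions `a, a'`
and policies `π` in the support of `ρ h`, where `h` is the layer of `x`. -/
def designRange (M : LayeredMDP X A) {d : ℕ} (φ : X → A → EuclideanSpace ℝ (Fin d))
    (θ : ℕ → Policy X A → EuclideanSpace ℝ (Fin d)) (ρ : ℕ → Policy X A →₀ ℝ) (x : X) : ℝ :=
  ⨆ p : A × A × (ρ (M.layerOf x)).support,
    ⟪φ x p.1 - φ x p.2.1, θ (M.layerOf x) (p.2.2 : Policy X A)⟫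

/-- The random variable `1{Rg(x_ℓ) ≥ γ} · ∏_{k=h+1}^{ℓ-1} 1{Rg(x_k) < γ} · f(x_ℓ)` on trajectories
`ω = ((x_k, a_k))_k`, where `Rg` is the design range. -/
def skipStep (M : LayeredMDP X A) {d : ℕ} (φ : X → A → EuclideanSpace ℝ (Fin d))
    (θ : ℕ → Policy X A → EuclideanSpace ℝ (Fin d)) (ρ : ℕ → Policy X A →₀ ℝ)
    (h ℓ : ℕ) (γ : ℝ) (f : X → ℝ) (ω : ℕ → X × A) : ℝ :=
  (if γ ≤ M.designRange φ θ ρ (ω ℓ).1 then 1 else 0) *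
    (∏ k ∈ Finset.Ioo h ℓ, if M.designRange φ θ ρ (ω k).1 < γ then 1 else 0) *
      f (ω ℓ).1

end LayeredMDP

/-- `B` is the Moore–Penrose pseudo-inverse of the real square matrix `G` (the four Penrose
equations, which determine `B` uniquely). -/
structure IsMoorePenroseInverse {d : ℕ} (G B : Matrix (Fin d) (Fin d) ℝ) : Prop where
  mul_mul_left : G * B * G = G
  mul_mul_right : B * G * B = B
  symm_left : (G * B).transpose = G * B
  symm_right : (B * G).transpose = B * G

/-- The matrix `G(ρ) = ∑_z ρ(z) c_z c_zᵀ`. -/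
def designMatrix {Z : Type*} {d : ℕ} (c : Z → EuclideanSpace ℝ (Fin d)) (ρ : Z →₀ ℝ) :
    Matrix (Fin d) (Fin d) ℝ :=
  ∑ z ∈ ρ.support, ρ z • Matrix.vecMulVec (c z).ofLp (c z).ofLp

/-- `ρ` is a finitely supported probability distribution on `Z` that is an approximate optimal
design for the family `c`: `c_zᵀ G(ρ)† c_z ≤ 2 d` for every `z`. -/
structure IsApproxDesign {Z : Type*} {d : ℕ} (c : Z → EuclideanSpace ℝ (Fin d))
    (ρ : Z →₀ ℝ) : Prop where
  nonneg : ∀ z, 0 ≤ ρ z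
  sum_eq_one : ∑ z ∈ ρ.support, ρ z = 1
  sq_norm_le : ∃ B, IsMoorePenroseInverse (designMatrix c ρ) B ∧
    ∀ z, (c z).ofLp ⬝ᵥ B.mulVec (c z).ofLp ≤ 2 * d

/-- The quantity `4 d log log d + 16` (for `d ≤ 1` the term `d log log d` reads as `0`). -/
def dTilde (d : ℕ) : ℝ := 4 * d * Real.log (Real.log d) + 16

end

/-! Differences of value functions are linear in the features, so every expectation that can be
written as such a difference is linear too. Let `V` be a function of the state at a later layer `k`,
and suppose that wherever `V ≠ 0` two actions `b x`, `c x` differ in value by at least `γ` under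
some policy `π'`. Follow `π` before `k` and `π'` after `k`. At `k`, randomize between `b` and `c` in
two ways whose probabilities of `b` differ by `γ V / (L · gap)`. By `val_glue_sub_val_glue` the two
values at layer `h` differ by `γ / L` times the expectation of `V`, which gives a parameter of norm
at most `2 H L / γ` (`exists_param_of_gap`). A state with design range at least `γ` has such a gap
for some policy in the support of the design. Splitting by that policy costs a factor `card support`
(`exists_param_of_designRange`). Finally, `1{Rg < γ} = 1 - 1{Rg ≥ γ}` is expanded one layer at a
time. Each of the at most `H` resulting terms carries a large-range indicator at its last relevant
layer, the rest being averaged into a function of that state bounded by `L`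
(`exists_param_skipIter`). -/

/-! ### Bounded measurable functions -/

/-- A bounded measurable real-valued function. -/
structure BddMeas {α : Type*} [MeasurableSpace α] (u : α → ℝ) : Prop where
  measurable : Measurable u
  bdd : ∃ C, ∀ x, |u x| ≤ C

namespace BddMeas

variable {α β : Type*} [MeasurableSpace α] [MeasurableSpace β] {u v : α → ℝ}

theorem integrable (hu : BddMeas u) (μ : Measure α) [IsFiniteMeasure μ] : Integrable u μ := by
  obtain ⟨C, hC⟩ := hu.bdd
  exact Integrable.of_bound hu.measurable.aestronglyMeasurable C (ae_of_all _ hC)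

theorem const (c : ℝ) : BddMeas fun _ : α => c := ⟨measurable_const, |c|, fun _ => le_rfl⟩

theorem add (hu : BddMeas u) (hv : BddMeas v) : BddMeas fun x => u x + v x := by
  obtain ⟨C, hC⟩ := hu.bdd
  obtain ⟨D, hD⟩ := hv.bdd
  exact ⟨hu.measurable.add hv.measurable, C + D,
    fun x => (abs_add_le _ _).trans (add_le_add (hC x) (hD x))⟩

theorem mul (hu : BddMeas u) (hv : BddMeas v) : BddMeas fun x => u x * v x := by
  obtain ⟨C, hC⟩ := hu.bdd
  obtain ⟨D, hD⟩ := hv.bdd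
  refine ⟨hu.measurable.mul hv.measurable, C * D, fun x => ?_⟩
  rw [abs_mul]
  exact mul_le_mul (hC x) (hD x) (abs_nonneg _) ((abs_nonneg _).trans (hC x))

theorem sub (hu : BddMeas u) (hv : BddMeas v) : BddMeas fun x => u x - v x := by
  simpa [sub_eq_add_neg] using hu.add ((const (-1)).mul hv)

theorem sum {ι : Type*} (s : Finset ι) {w : ι → α → ℝ} (hw : ∀ i ∈ s, BddMeas (w i)) :
    BddMeas fun x => ∑ i ∈ s, w i x := by
  classical
  induction s using Finset.induction_on with
  | empty => simpa using const 0
  | insert i s hi ih =>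
    simp only [Finset.sum_insert hi]
    exact (hw i (by simp)).add (ih fun j hj => hw j (by simp [hj]))

theorem prod {ι : Type*} (s : Finset ι) {w : ι → α → ℝ} (hw : ∀ i ∈ s, BddMeas (w i)) :
    BddMeas fun x => ∏ i ∈ s, w i x := by
  classical
  induction s using Finset.induction_on with
  | empty => simpa using const 1
  | insert i s hi ih =>
    simp only [Finset.prod_insert hi]
    exact (hw i (by simp)).mul (ih fun j hj => hw j (by simp [hj]))

theorem comp (hu : BddMeas u) {g : β → α} (hg : Measurable g) : BddMeas fun x => u (g x) := by
  obtain ⟨C, hC⟩ := hu.bdd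
  exact ⟨hu.measurable.comp hg, C, fun x => hC _⟩

theorem ite {s : α → Prop} [DecidablePred s] (hs : MeasurableSet {x | s x}) (hu : BddMeas u) (hv : BddMeas v) :
    BddMeas fun x => if s x then u x else v x := by
  obtain ⟨C, hC⟩ := hu.bdd
  obtain ⟨D, hD⟩ := hv.bdd
  refine ⟨Measurable.ite hs hu.measurable hv.measurable, max C D, fun x => ?_⟩
  split_ifs
  · exact (hC x).trans (le_max_left _ _)
  · exact (hD x).trans (le_max_right _ _)

theorem abs_integral_le {C : ℝ} (hC : ∀ x, |u x| ≤ C) (μ : Measure α) [IsProbabilityMeasure μ] :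
    |∫ x, u x ∂μ| ≤ C := by
  simpa using norm_integral_le_of_norm_le_const (μ := μ) (f := u) (ae_of_all _ hC)

theorem integral_kernel (hu : BddMeas u) (κ : Kernel β α) [IsMarkovKernel κ] :
    BddMeas fun y => ∫ x, u x ∂(κ y) := by
  obtain ⟨C, hC⟩ := hu.bdd
  exact ⟨(hu.measurable.stronglyMeasurable.integral_kernel (κ := κ)).measurable, C,
    fun y => abs_integral_le hC _⟩

end BddMeas

/-! ### The transition operator and the trajectory law -/

namespace LayeredMDP

variable {X A : Type*} [MeasurableSpace X] [MeasurableSpace A]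

/-- The transition operator of the state-action process:
`(T u)(x, a) = E[u(x', a')]` with `x' ∼ P(x, a)` and `a' ∼ π(x')`. -/
noncomputable def T (M : LayeredMDP X A) (π : Policy X A) (u : X × A → ℝ) (p : X × A) : ℝ :=
  ∫ q, u q ∂(M.step π p)

variable (M : LayeredMDP X A) (π : Policy X A)

theorem bddMeas_T {u : X × A → ℝ} (hu : BddMeas u) : BddMeas (M.T π u) :=
  hu.integral_kernel (M.step π)

theorem bddMeas_iterate_T {u : X × A → ℝ} (hu : BddMeas u) (n : ℕ) : BddMeas ((M.T π)^[n] u) := by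
  induction n generalizing u with
  | zero => exact hu
  | succ n ih => exact ih (M.bddMeas_T π hu)

theorem abs_T_le {u : X × A → ℝ} {C : ℝ} (hC : ∀ p, |u p| ≤ C) (p : X × A) : |M.T π u p| ≤ C :=
  BddMeas.abs_integral_le hC _

theorem T_eq {u : X × A → ℝ} (hu : BddMeas u) (p : X × A) :
    M.T π u p = ∫ x, ∫ a, u (x, a) ∂(π.act x) ∂(M.P p) := by
  unfold T step
  rw [integral_compProd]
  · simp [Kernel.prodMkLeft_apply]
  · exact hu.integrable _

theorem bddMeas_integral_act {u : X × A → ℝ} (hu : BddMeas u) :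
    BddMeas fun x => ∫ a, u (x, a) ∂(π.act x) := by
  obtain ⟨C, hC⟩ := hu.bdd
  exact ⟨(hu.measurable.stronglyMeasurable.integral_kernel_prod_right'
    (κ := π.act)).measurable, C, fun x => BddMeas.abs_integral_le (fun a => hC _) _⟩

theorem T_const_mul (c : ℝ) (u : X × A → ℝ) :
    M.T π (fun p => c * u p) = fun p => c * M.T π u p := by
  ext p
  exact integral_const_mul _ _

theorem T_sub {u v : X × A → ℝ} (hu : BddMeas u) (hv : BddMeas v) :
    M.T π (fun p => u p - v p) = fun p => M.T π u p - M.T π v p := by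
  ext p
  exact integral_sub (hu.integrable _) (hv.integrable _)

theorem T_sum {ι : Type*} (s : Finset ι) {w : ι → X × A → ℝ} (hw : ∀ i ∈ s, BddMeas (w i)) :
    M.T π (fun p => ∑ i ∈ s, w i p) = fun p => ∑ i ∈ s, M.T π (w i) p := by
  ext p
  exact integral_finsetSum _ fun i hi => (hw i hi).integrable _

theorem iterate_T_sub {u v : X × A → ℝ} (hu : BddMeas u) (hv : BddMeas v) (n : ℕ) :
    (M.T π)^[n] (fun p => u p - v p) = fun p => (M.T π)^[n] u p - (M.T π)^[n] v p := by
  induction n generalizing u v with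
  | zero => rfl
  | succ n ih =>
    simp only [Function.iterate_succ_apply]
    rw [T_sub _ _ hu hv, ih (M.bddMeas_T π hu) (M.bddMeas_T π hv)]

theorem iterate_T_const_mul (c : ℝ) (u : X × A → ℝ) (n : ℕ) :
    (M.T π)^[n] (fun p => c * u p) = fun p => c * (M.T π)^[n] u p := by
  induction n generalizing u with
  | zero => rfl
  | succ n ih => simp only [Function.iterate_succ_apply]; rw [T_const_mul, ih]

theorem iterate_T_sum {ι : Type*} (s : Finset ι) {w : ι → X × A → ℝ}
    (hw : ∀ i ∈ s, BddMeas (w i)) (n : ℕ) :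
    (M.T π)^[n] (fun p => ∑ i ∈ s, w i p) = fun p => ∑ i ∈ s, (M.T π)^[n] (w i) p := by
  induction n generalizing w with
  | zero => rfl
  | succ n ih =>
    simp only [Function.iterate_succ_apply]
    rw [T_sum _ _ _ hw, ih fun i hi => M.bddMeas_T π (hw i hi)]

instance (h : ℕ) (x : X) (a : A) : IsProbabilityMeasure (M.condLaw π h x a) := by
  unfold condLaw; infer_instance

/-- The Markov property: the last coordinate is integrated out by the transition operator. -/
theorem integral_condLaw_mul_succ {h n : ℕ} (hn : h ≤ n) (x : X) (a : A)
    {G : (Finset.Iic n → X × A) → ℝ} (hG : BddMeas G) {u : X × A → ℝ} (hu : BddMeas u) :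
    ∫ ω, G (Preorder.frestrictLe n ω) * u (ω (n + 1)) ∂(M.condLaw π h x a) =
      ∫ ω, G (Preorder.frestrictLe n ω) * M.T π u (ω n) ∂(M.condLaw π h x a) := by
  have hmap := Kernel.partialTraj_compProd_eq_map_traj (X := fun _ => X × A) (κ := M.histStep π)
    hn (x₀ := fun _ => (x, a))
  have hF : BddMeas fun z : (Finset.Iic n → X × A) × (X × A) => G z.1 * u z.2 :=
    (hG.comp measurable_fst).mul (hu.comp measurable_snd)
  have h1 : ∫ ω, G (Preorder.frestrictLe n ω) * u (ω (n + 1)) ∂(M.condLaw π h x a) =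
      ∫ z, G z.1 * u z.2 ∂((M.condLaw π h x a).map
        fun ω => (Preorder.frestrictLe n ω, ω (n + 1))) := by
    rw [integral_map]
    · exact Measurable.aemeasurable (by fun_prop)
    · exact hF.measurable.aestronglyMeasurable
  rw [h1, condLaw, ← hmap, Measure.integral_compProd (hF.integrable _),
    ← Kernel.traj_map_frestrictLe_apply, integral_map]
  · refine integral_congr_ae (ae_of_all _ fun ω => ?_)
    simp only [integral_const_mul]
    rfl
  · exact Measurable.aemeasurable (by fun_prop)
  · exact (hF.measurable.stronglyMeasurable.integral_kernel_prod_right'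
      (κ := M.histStep π n)).aestronglyMeasurable

theorem integral_condLaw_self (h : ℕ) (x : X) (a : A) {u : X × A → ℝ} (hu : BddMeas u) :
    ∫ ω, u (ω h) ∂(M.condLaw π h x a) = u (x, a) := by
  have hm : Measurable fun w : Finset.Iic h → X × A => u (w ⟨h, Finset.mem_Iic.2 le_rfl⟩) :=
    hu.measurable.comp (measurable_pi_apply _)
  have h1 := integral_map (μ := M.condLaw π h x a)
    (φ := Preorder.frestrictLe (π := fun _ => X × A) h)
    (Measurable.aemeasurable (by fun_prop)) hm.aestronglyMeasurable
  refine h1.symm.trans ?_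
  rw [condLaw, Kernel.traj_map_frestrictLe_apply, Kernel.partialTraj_self, Kernel.id_apply,
    integral_dirac' _ _ hm.stronglyMeasurable]

theorem integral_condLaw_add (h m : ℕ) (x : X) (a : A) {u : X × A → ℝ} (hu : BddMeas u) :
    ∫ ω, u (ω (h + m)) ∂(M.condLaw π h x a) = (M.T π)^[m] u (x, a) := by
  induction m generalizing u with
  | zero => exact M.integral_condLaw_self π h x a hu
  | succ m ih =>
    have := M.integral_condLaw_mul_succ π (Nat.le_add_right h m) x a (BddMeas.const 1) hu
    simp only [one_mul] at this
    rw [← add_assoc, this, ih (M.bddMeas_T π hu)]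
    rfl

/-- Expectation of a product over the trajectory in terms of iterated operators. -/
theorem integral_condLaw_prod_mul {g : X × A → ℝ} (hg : BddMeas g) (h m : ℕ) (x : X) (a : A)
    {u : X × A → ℝ} (hu : BddMeas u) :
    ∫ ω, (∏ k ∈ Finset.Ioo h (h + m + 1), g (ω k)) * u (ω (h + m + 1)) ∂(M.condLaw π h x a) =
      M.T π ((fun v p => g p * M.T π v p)^[m] u) (x, a) := by
  induction m generalizing u with
  | zero =>
    have hIoo : Finset.Ioo h (h + 1) = ∅ := by
      ext k; simp only [Finset.mem_Ioo, Finset.notMem_empty, iff_false]; omega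
    simpa [hIoo] using M.integral_condLaw_add π h 1 x a hu
  | succ m ih =>
    have hG : BddMeas fun w : Finset.Iic (h + m + 1) → X × A =>
        ∏ k ∈ (Finset.Ioo h (h + m + 2)).attach,
          g (w ⟨k.1, by have := Finset.mem_Ioo.1 k.2; exact Finset.mem_Iic.2 (by omega)⟩) :=
      BddMeas.prod _ fun k _ => hg.comp (measurable_pi_apply _)
    have hprod : ∀ ω : ℕ → X × A, ∏ k ∈ (Finset.Ioo h (h + m + 2)).attach, g (ω k.1) =
        ∏ k ∈ Finset.Ioo h (h + m + 2), g (ω k) := fun ω =>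
      Finset.prod_attach _ fun k => g (ω k)
    have key := M.integral_condLaw_mul_succ π (show h ≤ h + m + 1 by omega) x a hG hu
    simp only [Preorder.frestrictLe_apply, hprod] at key
    have hIoo : Finset.Ioo h (h + m + 2) = insert (h + m + 1) (Finset.Ioo h (h + m + 1)) := by
      ext k; simp only [Finset.mem_Ioo, Finset.mem_insert]; omega
    refine key.trans ?_
    -- The factor `g` at time `h + m + 1` is absorbed into the terminal function, which becomes `g *
    -- M.T π u`.
    rw [Function.iterate_succ_apply, ← ih (hg.mul (M.bddMeas_T π hu))]
    refine integral_congr_ae (ae_of_all _ fun ω => ?_)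
    simp only
    rw [hIoo, Finset.prod_insert (by simp)]
    ring

end LayeredMDP

/-! ### Measurable selection and randomized policies -/

theorem exists_measurable_selection {α ι : Type*} [MeasurableSpace α] [MeasurableSpace ι]
    [Finite ι] [Nonempty ι] {E : ι → Set α} (hE : ∀ i, MeasurableSet (E i)) :
    ∃ s : α → ι, Measurable s ∧ ∀ x, (∃ i, x ∈ E i) → x ∈ E (s x) := by
  classical
  have := Fintype.ofFinite ι
  suffices H : ∀ t : Finset ι, ∃ s : α → ι, Measurable s ∧ ∀ x, (∃ i ∈ t, x ∈ E i) → x ∈ E (s x) by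
    simpa using H Finset.univ
  intro t
  induction t using Finset.induction_on with
  | empty => exact ⟨fun _ => Classical.arbitrary ι, measurable_const, by simp⟩
  | insert i t _ ih =>
    obtain ⟨s, hs, hsE⟩ := ih
    refine ⟨(E i).piecewise (fun _ => i) s, Measurable.piecewise (hE i) measurable_const hs, ?_⟩
    rintro x ⟨j, hj, hxj⟩
    by_cases hx : x ∈ E i
    · simp [hx]
    · rw [Set.piecewise_eq_of_notMem _ _ _ hx]
      refine hsE x ⟨j, (Finset.mem_insert.1 hj).resolve_left ?_, hxj⟩
      rintro rfl
      exact hx hxj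

namespace Policy

variable {X A : Type*} [MeasurableSpace X] [MeasurableSpace A]

/-- The policy that plays the action `b x` with probability `p x` and the action `c x` with
probability `1 - p x`. -/
noncomputable def mix (p : X → ℝ) (hp : Measurable p) (hp01 : ∀ x, p x ∈ Set.Icc (0 : ℝ) 1)
    {b c : X → A} (hb : Measurable b) (hc : Measurable c) : Policy X A where
  act :=
    { toFun := fun x => ENNReal.ofReal (p x) • Measure.dirac (b x) +
        ENNReal.ofReal (1 - p x) • Measure.dirac (c x)
      measurable' := by
        refine Measure.measurable_of_measurable_coe _ fun s hs => ?_
        simp only [Measure.coe_add, Measure.coe_smul, Pi.add_apply, Pi.smul_apply, smul_eq_mul,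
          Measure.dirac_apply' _ hs]
        have hi : Measurable (s.indicator (1 : A → ENNReal)) := measurable_one.indicator hs
        exact (hp.ennreal_ofReal.mul (hi.comp hb)).add
          ((measurable_const.sub hp).ennreal_ofReal.mul (hi.comp hc)) }
  markov_act := by
    refine ⟨fun x => ⟨?_⟩⟩
    change (ENNReal.ofReal (p x) • Measure.dirac (b x) +
        ENNReal.ofReal (1 - p x) • Measure.dirac (c x)) Set.univ = 1
    simp only [Measure.coe_add, Measure.coe_smul, Pi.add_apply, Pi.smul_apply, smul_eq_mul,
      measure_univ, mul_one]
    rw [← ENNReal.ofReal_add (hp01 x).1 (by linarith [(hp01 x).2])]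
    simp

theorem integral_mix (p : X → ℝ) (hp : Measurable p) (hp01 : ∀ x, p x ∈ Set.Icc (0 : ℝ) 1)
    {b c : X → A} (hb : Measurable b) (hc : Measurable c) {u : A → ℝ} (hu : BddMeas u) (x : X) :
    ∫ a, u a ∂((mix p hp hp01 hb hc).act x) = p x * u (b x) + (1 - p x) * u (c x) := by
  change ∫ a, u a ∂(ENNReal.ofReal (p x) • Measure.dirac (b x) +
        ENNReal.ofReal (1 - p x) • Measure.dirac (c x)) = _
  rw [integral_add_measure ((hu.integrable _).smul_measure ENNReal.ofReal_ne_top)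
    ((hu.integrable _).smul_measure ENNReal.ofReal_ne_top), integral_smul_measure,
    integral_smul_measure, integral_dirac' _ _ hu.measurable.stronglyMeasurable,
    integral_dirac' _ _ hu.measurable.stronglyMeasurable, ENNReal.toReal_ofReal (hp01 x).1,
    ENNReal.toReal_ofReal (by linarith [(hp01 x).2])]
  rfl

end Policy

/-! ### Restriction to layers -/

namespace LayeredMDP

variable {X A : Type*} [MeasurableSpace X] [MeasurableSpace A]
variable (M : LayeredMDP X A)

/-- The next state lies almost surely in layer `j + 1`, so only action averages on that layer
matter. Varying policy and function together covers both kinds of replacement. -/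
theorem T_congr {π π' : Policy X A} {u v : X × A → ℝ} (hu : BddMeas u) (hv : BddMeas v)
    {j : ℕ} (hj : j < M.H)
    (h : ∀ x ∈ M.layer (j + 1), ∫ a, u (x, a) ∂(π.act x) = ∫ a, v (x, a) ∂(π'.act x))
    {x : X} (hx : x ∈ M.layer j) (a : A) : M.T π u (x, a) = M.T π' v (x, a) := by
  rw [T_eq _ _ hu, T_eq _ _ hv]
  have hx' : M.layerOf x = j := hx
  refine integral_congr_ae ?_
  filter_upwards [M.P_layer x a (by omega)] with y hy
  exact h y (by rw [layer, Set.mem_ofPred_eq, hy, hx'])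

theorem iterate_T_congr (π : Policy X A) {u v : X × A → ℝ} (hu : BddMeas u) (hv : BddMeas v)
    {h m : ℕ} (hm : h + m ≤ M.H) (huv : ∀ x ∈ M.layer (h + m), ∀ a, u (x, a) = v (x, a))
    {x : X} (hx : x ∈ M.layer h) (a : A) : (M.T π)^[m] u (x, a) = (M.T π)^[m] v (x, a) := by
  induction m generalizing u v with
  | zero => exact huv x hx a
  | succ m ih =>
    rw [Function.iterate_succ_apply, Function.iterate_succ_apply]
    refine ih (M.bddMeas_T π hu) (M.bddMeas_T π hv) (by omega) fun y hy b => ?_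
    exact M.T_congr hu hv (by omega) (fun z hz => by simp only [huv z hz]) hy b

/-- The indicator of the layer agrees there with the constant `1`, which `M.T π` preserves; hence
its expectation is `1`. -/
theorem ae_condLaw_layer (π : Policy X A) {h m : ℕ} (hm : h + m ≤ M.H) {x : X}
    (hx : x ∈ M.layer h) (a : A) :
    ∀ᵐ ω ∂(M.condLaw π h x a), (ω (h + m)).1 ∈ M.layer (h + m) := by
  have hS : MeasurableSet (M.layer (h + m)) := M.measurable_layerOf (measurableSet_singleton _)
  have hS' : MeasurableSet {ω : ℕ → X × A | (ω (h + m)).1 ∈ M.layer (h + m)} :=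
    (measurable_fst.comp (measurable_pi_apply (h + m))) hS
  have hu : BddMeas fun p : X × A => (M.layer (h + m)).indicator (fun _ => (1 : ℝ)) p.1 := by
    classical
    exact (BddMeas.ite (s := fun x => x ∈ M.layer (h + m)) hS (.const 1) (.const 0)).comp
      measurable_fst
  have h1 := M.integral_condLaw_add π h m x a hu
  have hT : ∀ n, (M.T π)^[n] (fun _ => (1 : ℝ)) = fun _ => 1 := by
    intro n
    induction n with
    | zero => rfl
    | succ n ih =>
      rw [Function.iterate_succ_apply', ih]; ext p; simp [T]
  rw [M.iterate_T_congr π hu (.const 1) hm (fun y hy b => by simp [hy]) hx a, hT] at h1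
  have h2 : ∫ ω, {ω : ℕ → X × A | (ω (h + m)).1 ∈ M.layer (h + m)}.indicator
      (fun _ => (1 : ℝ)) ω ∂(M.condLaw π h x a) = 1 := h1
  rw [integral_indicator_const _ hS', smul_eq_mul, mul_one] at h2
  refine (mem_ae_iff_prob_eq_one hS').2 ?_
  rwa [measureReal_def, ENNReal.toReal_eq_one_iff] at h2

theorem bddMeas_R : BddMeas fun p : X × A => M.R p.1 p.2 :=
  ⟨M.measurable_R, 1, fun p => abs_le.2
    ⟨by linarith [(M.R_mem p.1 p.2).1], (M.R_mem p.1 p.2).2⟩⟩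

/-! ### Value functions and the Bellman equation -/

/-- The state-action value function in terms of the transition operator. -/
noncomputable def val (π : Policy X A) (j : ℕ) (p : X × A) : ℝ :=
  ∑ k ∈ Finset.Icc j M.H, (M.T π)^[k - j] (fun p => M.R p.1 p.2) p

theorem bddMeas_val (π : Policy X A) (j : ℕ) : BddMeas (M.val π j) :=
  BddMeas.sum _ fun _ _ => M.bddMeas_iterate_T π M.bddMeas_R _

theorem Q_eq_val (π : Policy X A) (j : ℕ) (x : X) (a : A) : M.Q π j x a = M.val π j (x, a) := by
  unfold Q val
  rw [integral_finsetSum]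
  · refine Finset.sum_congr rfl fun k hk => ?_
    have := M.integral_condLaw_add π j (k - j) x a M.bddMeas_R
    rwa [Nat.add_sub_cancel' (Finset.mem_Icc.1 hk).1] at this
  · exact fun k _ => (M.bddMeas_R.comp (measurable_pi_apply k)).integrable _

theorem val_eq (π : Policy X A) {j : ℕ} (hj : j ≤ M.H) (p : X × A) :
    M.val π j p = M.R p.1 p.2 + M.T π (M.val π (j + 1)) p := by
  have hI : Finset.Icc j M.H = insert j (Finset.Icc (j + 1) M.H) := by
    ext k; simp only [Finset.mem_Icc, Finset.mem_insert]; omega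
  have hT := M.T_sum π (Finset.Icc (j + 1) M.H)
    (w := fun k => (M.T π)^[k - (j + 1)] (fun p => M.R p.1 p.2))
    fun k _ => M.bddMeas_iterate_T π M.bddMeas_R _
  have hT' : M.T π (M.val π (j + 1)) p = _ := congrFun hT p
  rw [hT', val, hI, Finset.sum_insert (by simp)]
  simp only [Nat.sub_self, Function.iterate_zero, id]
  congr 1
  refine Finset.sum_congr rfl fun k hk => ?_
  have := (Finset.mem_Icc.1 hk).1
  rw [← Function.iterate_succ_apply' (M.T π), show k - j = (k - (j + 1)).succ by omega]

theorem val_succ_H (π : Policy X A) : M.val π (M.H + 1) = fun _ => 0 := by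
  ext p; simp [val]

/-- The value function at layer `j` depends only on the policy at later layers. -/
theorem val_congr {π π' : Policy X A} {j : ℕ} (hj : j ≤ M.H)
    (h : ∀ x, j < M.layerOf x → π.act x = π'.act x) {x : X} (hx : x ∈ M.layer j) (a : A) :
    M.val π j (x, a) = M.val π' j (x, a) := by
  induction hn : M.H - j generalizing j x a with
  | zero =>
    obtain rfl : j = M.H := by omega
    rw [val_eq _ _ le_rfl, val_eq _ _ le_rfl, val_succ_H, val_succ_H]
    simp [T]
  | succ n ih =>
    rw [val_eq _ _ hj, val_eq _ _ hj]
    congr 1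
    refine M.T_congr (M.bddMeas_val _ _) (M.bddMeas_val _ _) (by omega) (fun y hy => ?_) hx a
    have hy' : M.layerOf y = j + 1 := hy
    rw [h y (by omega)]
    refine integral_congr_ae (ae_of_all _ fun b => ?_)
    exact ih (by omega) (fun z hz => h z (by omega)) hy b (by omega)

/-! ### Glued policies and value differences -/

open Classical in
/-- The policy that follows `π` before layer `k`, `σ` at layer `k` and `π'` after layer `k`. -/
noncomputable def glue (k : ℕ) (π σ π' : Policy X A) : Policy X A where
  act := Kernel.piecewise (s := M.layerOf ⁻¹' Set.Iio k)
    (M.measurable_layerOf (measurableSet_Iio (a := k))) π.act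
    (Kernel.piecewise (s := M.layerOf ⁻¹' {k})
      (M.measurable_layerOf (measurableSet_singleton k)) σ.act π'.act)
  markov_act := inferInstance

theorem glue_act_of_lt {k : ℕ} (π σ π' : Policy X A) {x : X} (hx : M.layerOf x < k) :
    (M.glue k π σ π').act x = π.act x := by
  simp [glue, Kernel.piecewise_apply, hx]

theorem glue_act_of_eq {k : ℕ} (π σ π' : Policy X A) {x : X} (hx : M.layerOf x = k) :
    (M.glue k π σ π').act x = σ.act x := by
  simp [glue, Kernel.piecewise_apply, hx]

theorem glue_act_of_gt {k : ℕ} (π σ π' : Policy X A) {x : X} (hx : k < M.layerOf x) :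
    (M.glue k π σ π').act x = π'.act x := by
  simp [glue, Kernel.piecewise_apply, hx.not_gt, hx.ne']

/-- The difference between the values of two policies that differ only at layer `j + m + 1`. -/
theorem val_glue_sub_val_glue (π σ σ' π' : Policy X A) {j m k : ℕ} (hk : k = j + m + 1)
    (hkH : k ≤ M.H) {W : X → ℝ} (hW : BddMeas W)
    (hWk : ∀ x ∈ M.layer k, W x =
      ∫ a, M.val π' k (x, a) ∂(σ.act x) - ∫ a, M.val π' k (x, a) ∂(σ'.act x))
    {x : X} (hx : x ∈ M.layer j) (a : A) :
    M.val (M.glue k π σ π') j (x, a) - M.val (M.glue k π σ' π') j (x, a) =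
      (M.T π)^[m + 1] (fun p => W p.1) (x, a) := by
  have hW' : BddMeas fun p : X × A => W p.1 := hW.comp measurable_fst
  rw [val_eq _ _ (by omega), val_eq _ _ (by omega), add_sub_add_left_eq_sub]
  induction m generalizing j x a with
  | zero =>
    obtain rfl : k = j + 1 := hk
    have hB : ∀ τ : Policy X A,
        BddMeas fun p : X × A => ∫ b, M.val π' (j + 1) (p.1, b) ∂(τ.act p.1) := fun τ =>
      (bddMeas_integral_act τ (M.bddMeas_val π' (j + 1))).comp measurable_fst
    have hstep : ∀ τ : Policy X A, M.T (M.glue (j + 1) π τ π')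
        (M.val (M.glue (j + 1) π τ π') (j + 1)) (x, a) =
        M.T π (fun p => ∫ b, M.val π' (j + 1) (p.1, b) ∂(τ.act p.1)) (x, a) := by
      intro τ
      refine M.T_congr (M.bddMeas_val _ _) (hB τ) (by omega) (fun y hy => ?_) hx a
      rw [M.glue_act_of_eq _ _ _ hy]
      -- The replacement function depends on the state only, so averaging it over actions of `π`
      -- changes nothing.
      simp only [integral_const, probReal_univ, one_smul]
      refine integral_congr_ae (ae_of_all _ fun b => ?_)
      exact M.val_congr hkH (fun z hz => M.glue_act_of_gt _ _ _ hz) hy b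
    rw [hstep, hstep]
    have := congrFun (M.T_sub π (hB σ) (hB σ')) (x, a)
    rw [← this]
    exact M.T_congr ((hB σ).sub (hB σ')) hW' (by omega) (fun y hy => by simp [hWk y hy]) hx a
  | succ m ih =>
    have hstep : ∀ τ : Policy X A, M.T (M.glue k π τ π')
        (M.val (M.glue k π τ π') (j + 1)) (x, a) =
        M.T π (M.val (M.glue k π τ π') (j + 1)) (x, a) := by
      intro τ
      refine M.T_congr (M.bddMeas_val _ _) (M.bddMeas_val _ _) (by omega) (fun y hy => ?_) hx a
      have hy' : M.layerOf y = j + 1 := hy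
      rw [M.glue_act_of_lt _ _ _ (by omega)]
    rw [hstep, hstep, Function.iterate_succ_apply']
    have := congrFun (M.T_sub π (M.bddMeas_val (M.glue k π σ π') (j + 1))
      (M.bddMeas_val (M.glue k π σ' π') (j + 1))) (x, a)
    rw [← this]
    refine M.T_congr ((M.bddMeas_val _ _).sub (M.bddMeas_val _ _)) (M.bddMeas_iterate_T π hW' _)
      (by omega) (fun y hy => ?_) hx a
    refine integral_congr_ae (ae_of_all _ fun b => ?_)
    simp only
    rw [val_eq _ _ (by omega), val_eq _ _ (by omega), add_sub_add_left_eq_sub]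
    exact ih (by omega) hy b

end LayeredMDP

/-! ### Linearity from value gaps and from large design range -/

namespace LayeredMDP

variable {X A : Type*} [MeasurableSpace X] [MeasurableSpace A]
variable {M : LayeredMDP X A} {d : ℕ} {φ : X → A → EuclideanSpace ℝ (Fin d)}
  {θ : ℕ → Policy X A → EuclideanSpace ℝ (Fin d)}

theorem IsLinearlyRealizable.inner_eq_val (hθ : M.IsLinearlyRealizable φ θ) {j : ℕ}
    (hj : j ∈ Finset.Icc 1 M.H) (π : Policy X A) {x : X} (hx : x ∈ M.layer j) (a : A) :
    ⟪φ x a, θ j π⟫ = M.val π j (x, a) := by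
  rw [← hθ.Q_eq j hj π x hx a, Q_eq_val]

/-- If two actions have a gap of at least `γ` in the value of a fixed policy wherever `V ≠ 0`, the
expectation of `V` at a later layer is linear in the features. -/
theorem IsLinearlyRealizable.exists_param_of_gap (hθ : M.IsLinearlyRealizable φ θ)
    (π π' : Policy X A) {h m : ℕ} (hh : 1 ≤ h) (hm : h + m + 1 ≤ M.H) {γ L : ℝ} (hγ : 0 < γ)
    (hL : 0 < L) {V : X → ℝ} (hV : BddMeas V) (hVL : ∀ x, |V x| ≤ L) {b c : X → A}
    (hb : Measurable b) (hc : Measurable c)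
    (hgap : ∀ x ∈ M.layer (h + m + 1), V x ≠ 0 →
      γ ≤ M.val π' (h + m + 1) (x, b x) - M.val π' (h + m + 1) (x, c x)) :
    ∃ w : EuclideanSpace ℝ (Fin d), ‖w‖ ≤ 2 * M.H * L / γ ∧ ∀ x ∈ M.layer h, ∀ a : A,
      (M.T π)^[m + 1] (fun p => V p.1) (x, a) = ⟪φ x a, w⟫ := by
  set k := h + m + 1 with hk
  set gap : X → ℝ := fun x => M.val π' k (x, b x) - M.val π' k (x, c x) with hgapdef
  have hgm : Measurable gap :=
    ((M.bddMeas_val π' k).measurable.comp (measurable_id.prodMk hb)).sub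
      ((M.bddMeas_val π' k).measurable.comp (measurable_id.prodMk hc))
  -- The maximum with `γ` keeps the quotients below in `[0, 1]` at all states, also where the gap is
  -- small; it equals the gap wherever `V ≠ 0`.
  set den : X → ℝ := fun x => L * max γ (gap x) with hden
  have hdenm : Measurable den := (measurable_const.max hgm).const_mul L
  have hden_ge : ∀ x, L * γ ≤ den x := fun x =>
    mul_le_mul_of_nonneg_left (le_max_left _ _) hL.le
  have hden_pos : ∀ x, 0 < den x := fun x => (mul_pos hL hγ).trans_le (hden_ge x)
  have hprob : ∀ t : X → ℝ, (∀ x, |t x| ≤ L) → ∀ x,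
      γ * max (t x) 0 / den x ∈ Set.Icc (0 : ℝ) 1 := by
    intro t ht x
    refine ⟨div_nonneg (mul_nonneg hγ.le (le_max_right _ _)) (hden_pos x).le, ?_⟩
    rw [div_le_one (hden_pos x)]
    refine le_trans ?_ (hden_ge x)
    rw [mul_comm L]
    exact mul_le_mul_of_nonneg_left (max_le ((le_abs_self _).trans (ht x)) hL.le) hγ.le
  have hmeas : ∀ t : X → ℝ, Measurable t → Measurable fun x => γ * max (t x) 0 / den x :=
    fun t ht => ((ht.max measurable_const).const_mul γ).div hdenm
  have hVn : ∀ x, |(-V x)| ≤ L := fun x => by rw [abs_neg]; exact hVL x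
  -- The positive and negative parts of `V` drive the two policies, so their probabilities of `b`
  -- differ by `γ V / den`.
  let σ := Policy.mix _ (hmeas V hV.measurable) (hprob V hVL) hb hc
  let σ' := Policy.mix _ (hmeas (fun x => -V x) hV.measurable.neg) (hprob _ hVn) hb hc
  have hval : ∀ x, BddMeas fun a => M.val π' k (x, a) := fun x =>
    (M.bddMeas_val π' k).comp measurable_prodMk_left
  have hW : ∀ x ∈ M.layer k, γ / L * V x =
      ∫ a, M.val π' k (x, a) ∂(σ.act x) - ∫ a, M.val π' k (x, a) ∂(σ'.act x) := by
    intro x hx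
    rw [Policy.integral_mix _ _ _ _ _ (hval x), Policy.integral_mix _ _ _ _ _ (hval x)]
    have hV0 : max (V x) 0 - max (-V x) 0 = V x := by
      rcases le_total 0 (V x) with h0 | h0
      · rw [max_eq_left h0, max_eq_right (by linarith)]; ring
      · rw [max_eq_right h0, max_eq_left (by linarith)]; ring
    have hsplit : ∀ s t u v : ℝ, s * u + (1 - s) * v - (t * u + (1 - t) * v) =
        (s - t) * (u - v) := fun s t u v => by ring
    rw [hsplit, ← sub_div, ← mul_sub, hV0]
    by_cases hVx : V x = 0
    · simp [hVx]
    · have hg : γ ≤ gap x := hgap x hx hVx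
      have hd : den x = L * gap x := by simp only [hden, max_eq_right hg]
      have hgpos : gap x ≠ 0 := (hγ.trans_le hg).ne'
      change _ = γ * V x / den x * gap x
      rw [hd]
      field_simp
  have hWb : BddMeas fun x => γ / L * V x := (BddMeas.const _).mul hV
  have hhH : h ∈ Finset.Icc 1 M.H := Finset.mem_Icc.2 ⟨hh, by omega⟩
  refine ⟨(L / γ) • (θ h (M.glue k π σ π') - θ h (M.glue k π σ' π')), ?_, fun x hx a => ?_⟩
  · rw [norm_smul, Real.norm_of_nonneg (div_pos hL hγ).le]
    have h1 := norm_sub_le (θ h (M.glue k π σ π')) (θ h (M.glue k π σ' π'))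
    have h2 := hθ.norm_param_le h hhH (M.glue k π σ π')
    have h3 := hθ.norm_param_le h hhH (M.glue k π σ' π')
    calc L / γ * ‖θ h (M.glue k π σ π') - θ h (M.glue k π σ' π')‖
        ≤ L / γ * (2 * M.H) := mul_le_mul_of_nonneg_left (by linarith) (div_pos hL hγ).le
      _ = 2 * M.H * L / γ := by ring
  · have key := M.val_glue_sub_val_glue π σ σ' π' hk hm hWb hW hx a
    rw [inner_smul_right, inner_sub_right, hθ.inner_eq_val hhH _ hx, hθ.inner_eq_val hhH _ hx, key,
      M.iterate_T_const_mul π (γ / L) (fun p => V p.1)]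
    field_simp

variable {ρ : ℕ → Policy X A →₀ ℝ}

/-- The feature map need not be measurable; value functions are, and measurability of the design
range is obtained through them. -/
theorem IsLinearlyRealizable.designRange_eq (hθ : M.IsLinearlyRealizable φ θ) {j : ℕ} {x : X}
    (hx : x ∈ M.layer j) :
    M.designRange φ θ ρ x = ⨆ p : A × A × (ρ j).support,
      (M.val p.2.2 j (x, p.1) - M.val p.2.2 j (x, p.2.1)) := by
  have hj : j ∈ Finset.Icc 1 M.H := by
    have := M.layerOf_mem x
    rwa [show M.layerOf x = j from hx] at this
  obtain rfl : M.layerOf x = j := hx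
  unfold designRange
  congr 1 with p
  rw [inner_sub_left, hθ.inner_eq_val hj _ rfl, hθ.inner_eq_val hj _ rfl]

theorem measurable_val_sub (π : Policy X A) (j : ℕ) (a b : A) :
    Measurable fun x => M.val π j (x, a) - M.val π j (x, b) :=
  ((M.bddMeas_val π j).measurable.comp measurable_prodMk_right).sub
    ((M.bddMeas_val π j).measurable.comp measurable_prodMk_right)

/-- The operator `v ↦ 1{Rg < γ} · T v` applied `m` times to `1{Rg ≥ γ} · f`. -/
noncomputable def skipIter (M : LayeredMDP X A) (φ : X → A → EuclideanSpace ℝ (Fin d))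
    (θ : ℕ → Policy X A → EuclideanSpace ℝ (Fin d)) (ρ : ℕ → Policy X A →₀ ℝ) (γ : ℝ)
    (π : Policy X A) (f : X → ℝ) (m : ℕ) : X × A → ℝ :=
  (fun v p => (if M.designRange φ θ ρ p.1 < γ then 1 else 0) * M.T π v p)^[m]
    fun p => (if γ ≤ M.designRange φ θ ρ p.1 then 1 else 0) * f p.1

theorem skipIter_succ (γ : ℝ) (π : Policy X A) (f : X → ℝ) (m : ℕ) :
    M.skipIter φ θ ρ γ π f (m + 1) = fun p =>
      (if M.designRange φ θ ρ p.1 < γ then 1 else 0) * M.T π (M.skipIter φ θ ρ γ π f m) p := by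
  unfold skipIter
  rw [Function.iterate_succ_apply']

theorem abs_skipIter_le (γ : ℝ) (π : Policy X A) {f : X → ℝ} {L : ℝ} (hL : 0 ≤ L)
    (hf : ∀ x, |f x| ≤ L) (m : ℕ) (p : X × A) : |M.skipIter φ θ ρ γ π f m p| ≤ L := by
  induction m generalizing p with
  | zero =>
    simp only [skipIter, Function.iterate_zero, id]
    split_ifs
    · simpa using hf p.1
    · simpa using hL
  | succ m ih =>
    rw [skipIter_succ]
    simp only
    split_ifs
    · simpa using M.abs_T_le π ih p
    · simpa using hL

variable [Fintype A]

theorem IsLinearlyRealizable.measurable_designRange (hθ : M.IsLinearlyRealizable φ θ) :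
    Measurable (M.designRange φ θ ρ) := by
  have hF : Measurable fun q : ℕ × X => ⨆ p : A × A × (ρ q.1).support,
      (M.val p.2.2 q.1 (q.2, p.1) - M.val p.2.2 q.1 (q.2, p.2.1)) :=
    measurable_from_prod_countable_right fun j =>
      Measurable.iSup (f := fun (p : A × A × (ρ j).support) (x : X) =>
        M.val p.2.2 j (x, p.1) - M.val p.2.2 j (x, p.2.1))
        fun p => measurable_val_sub (p.2.2 : Policy X A) j p.1 p.2.1
  have h := hF.comp (M.measurable_layerOf.prodMk measurable_id)
  convert h using 1
  ext x
  exact hθ.designRange_eq rfl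

theorem IsLinearlyRealizable.bddMeas_ite_lt (hθ : M.IsLinearlyRealizable φ θ) (γ : ℝ) :
    BddMeas fun p : X × A => if M.designRange φ θ ρ p.1 < γ then (1 : ℝ) else 0 := by
  have := BddMeas.ite (measurableSet_lt (hθ.measurable_designRange (ρ := ρ)) measurable_const)
    (.const 1) (.const 0) (s := fun x => M.designRange φ θ ρ x < γ)
  exact this.comp measurable_fst

theorem IsLinearlyRealizable.bddMeas_ite_le (hθ : M.IsLinearlyRealizable φ θ) (γ : ℝ) :
    BddMeas fun p : X × A => if γ ≤ M.designRange φ θ ρ p.1 then (1 : ℝ) else 0 := by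
  have := BddMeas.ite (measurableSet_le measurable_const (hθ.measurable_designRange (ρ := ρ)))
    (.const 1) (.const 0) (s := fun x => γ ≤ M.designRange φ θ ρ x)
  exact this.comp measurable_fst

theorem IsLinearlyRealizable.bddMeas_skipIter (hθ : M.IsLinearlyRealizable φ θ) (γ : ℝ)
    (π : Policy X A) {f : X → ℝ} (hf : BddMeas f) (m : ℕ) :
    BddMeas (M.skipIter φ θ ρ γ π f m) := by
  induction m with
  | zero => exact (hθ.bddMeas_ite_le γ).mul (hf.comp measurable_fst)
  | succ m ih =>
    rw [skipIter_succ]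
    exact (hθ.bddMeas_ite_lt γ).mul (M.bddMeas_T π ih)

/-- The expectation of a bounded function restricted to states of large design range at a later
layer is linear in the features. -/
theorem IsLinearlyRealizable.exists_param_of_designRange (hθ : M.IsLinearlyRealizable φ θ)
    (π : Policy X A) {h m : ℕ} (hh : 1 ≤ h) (hm : h + m + 1 ≤ M.H) {γ L : ℝ} (hγ : 0 < γ)
    (hL : 0 < L) {V : X → ℝ} (hV : BddMeas V) (hVL : ∀ x, |V x| ≤ L) :
    ∃ w : EuclideanSpace ℝ (Fin d), ‖w‖ ≤ (ρ (h + m + 1)).support.card * (2 * M.H * L / γ) ∧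
      ∀ x ∈ M.layer h, ∀ a : A, (M.T π)^[m + 1]
        (fun p => (if γ ≤ M.designRange φ θ ρ p.1 then 1 else 0) * V p.1) (x, a) =
          ⟪φ x a, w⟫ := by
  classical
  set k := h + m + 1 with hk
  have hS : MeasurableSet {x | γ ≤ M.designRange φ θ ρ x} :=
    measurableSet_le measurable_const hθ.measurable_designRange
  have hF : BddMeas fun x => (if γ ≤ M.designRange φ θ ρ x then 1 else 0) * V x :=
    (BddMeas.ite hS (.const 1) (.const 0)).mul hV
  have hF' : BddMeas fun p : X × A =>
    (if γ ≤ M.designRange φ θ ρ p.1 then 1 else 0) * V p.1 := hF.comp measurable_fst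
  let _ : MeasurableSpace (ρ k).support := ⊤
  -- A real supremum over an empty family is `0 < γ`, so the indicator then vanishes on layer `k`.
  rcases isEmpty_or_nonempty (A × A × (ρ k).support) with hι | hι
  · refine ⟨0, ?_, fun x hx a => ?_⟩
    · rw [norm_zero]; positivity
    · rw [M.iterate_T_congr π (m := m + 1) hF' (.const 0) hm _ hx a]
      · have hT : ∀ n, (M.T π)^[n] (fun _ => (0 : ℝ)) = fun _ => 0 := by
          intro n
          induction n with
          | zero => rfl
          | succ n ih => rw [Function.iterate_succ_apply', ih]; ext p; simp [T]
        rw [hT, inner_zero_right]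
      · intro y hy b
        rw [hθ.designRange_eq hy, Real.iSup_of_isEmpty, if_neg (not_le.2 hγ), zero_mul]
  obtain ⟨s, hs, hsE⟩ := exists_measurable_selection (ι := A × A × (ρ k).support)
    (E := fun p => {x | γ ≤ M.val p.2.2 k (x, p.1) - M.val p.2.2 k (x, p.2.1)})
    fun p => measurableSet_le measurable_const (measurable_val_sub (p.2.2 : Policy X A) k _ _)
  have hsi : ∀ i, MeasurableSet {x | (s x).2.2 = i} := fun i =>
    (measurable_snd.comp (measurable_snd.comp hs)) (MeasurableSpace.measurableSet_top (s := {i}))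
  -- The pieces are indexed by the selected policy alone. The selected actions may vary with the
  -- state, so no factor in the number of actions appears.
  let V' : (ρ k).support → X → ℝ := fun i x =>
    if (s x).2.2 = i then (if γ ≤ M.designRange φ θ ρ x then 1 else 0) * V x else 0
  have hV' : ∀ i, BddMeas (V' i) := fun i => BddMeas.ite (hsi i) hF (.const 0)
  have hV'L : ∀ i x, |V' i x| ≤ L := by
    intro i x
    simp only [V']
    split_ifs
    · simpa using hVL x
    · simpa using hL.le
    · simpa using hL.le
  have hex : ∀ i : (ρ k).support, ∃ w : EuclideanSpace ℝ (Fin d), ‖w‖ ≤ 2 * M.H * L / γ ∧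
      ∀ x ∈ M.layer h, ∀ a : A, (M.T π)^[m + 1] (fun p => V' i p.1) (x, a) = ⟪φ x a, w⟫ := by
    intro i
    refine hθ.exists_param_of_gap π i hh hm hγ hL (hV' i) (hV'L i) (measurable_fst.comp hs)
      (measurable_fst.comp (measurable_snd.comp hs)) fun x hx hVx => ?_
    simp only [V'] at hVx
    split_ifs at hVx with h1 h2
    · subst h1
      refine hsE x ?_
      rw [hθ.designRange_eq hx] at h2
      obtain ⟨p, hp⟩ := exists_eq_ciSup_of_finite (f := fun p : A × A × (ρ k).support =>
        M.val p.2.2 k (x, p.1) - M.val p.2.2 k (x, p.2.1))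
      exact ⟨p, h2.trans_eq hp.symm⟩
    · simp at hVx
    · simp at hVx
  choose w hw hwx using hex
  refine ⟨∑ i, w i, ?_, fun x hx a => ?_⟩
  · refine (norm_sum_le _ _).trans ((Finset.sum_le_sum fun i _ => hw i).trans_eq ?_)
    simp
  · have hsum : (fun p : X × A => (if γ ≤ M.designRange φ θ ρ p.1 then 1 else 0) * V p.1) =
        fun p => ∑ i, V' i p.1 := by
      ext p
      simp [V']
    rw [hsum, M.iterate_T_sum π _ fun i _ => (hV' i).comp measurable_fst, inner_sum]
    exact Finset.sum_congr rfl fun i _ => hwx i x hx a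

/-! ### The skip-step expectation -/

/-- Splitting according to the last layer of large design range before the target layer. -/
theorem IsLinearlyRealizable.exists_param_skipIter (hθ : M.IsLinearlyRealizable φ θ)
    {N : ℝ} (hρ : ∀ j ∈ Finset.Icc 1 M.H, ((ρ j).support.card : ℝ) ≤ N)
    (π : Policy X A) {γ L : ℝ} (hγ : 0 < γ) (hL : 0 < L) {f : X → ℝ} (hf : BddMeas f)
    (hfL : ∀ x, |f x| ≤ L) (m : ℕ) {h n : ℕ} (hh : 1 ≤ h) (hm : h + n + m + 1 ≤ M.H) :
    ∃ w : EuclideanSpace ℝ (Fin d), ‖w‖ ≤ (m + 1) * (N * (2 * M.H * L / γ)) ∧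
      ∀ x ∈ M.layer h, ∀ a : A, (M.T π)^[n + 1] (M.skipIter φ θ ρ γ π f m) (x, a) =
        ⟪φ x a, w⟫ := by
  have hC : (0 : ℝ) ≤ 2 * M.H * L / γ := by positivity
  induction m generalizing n with
  | zero =>
    obtain ⟨w, hw, hwx⟩ := hθ.exists_param_of_designRange (ρ := ρ) π (h := h) (m := n) hh
      (by omega) hγ hL hf hfL
    refine ⟨w, hw.trans ?_, hwx⟩
    have := mul_le_mul_of_nonneg_right
      (hρ (h + n + 1) (Finset.mem_Icc.2 ⟨by omega, by omega⟩)) hC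
    simpa using this
  | succ m ih =>
    have hU := hθ.bddMeas_skipIter (ρ := ρ) γ π hf m
    have hTU := M.bddMeas_T π hU
    have hV := bddMeas_integral_act π hTU
    -- Without the indicator at layer `h + n + 1`, one more free transition precedes a shorter
    -- product; this is why `n` is generalized.
    obtain ⟨w₁, hw₁, hwx₁⟩ := ih (n := n + 1) (by omega)
    -- The subtracted term has large range at layer `h + n + 1`. Its continuation depends on the
    -- action as well, and is averaged over `π` to become a function of the state.
    obtain ⟨w₂, hw₂, hwx₂⟩ := hθ.exists_param_of_designRange (ρ := ρ) π (h := h) (m := n) hh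
      (by omega) hγ hL hV fun x => BddMeas.abs_integral_le
        (fun a => M.abs_T_le π (abs_skipIter_le (ρ := ρ) γ π hL.le hfL m) (x, a)) _
    have hw₂' := hw₂.trans (mul_le_mul_of_nonneg_right
      (hρ (h + n + 1) (Finset.mem_Icc.2 ⟨by omega, by omega⟩)) hC)
    refine ⟨w₁ - w₂, (norm_sub_le _ _).trans ((add_le_add hw₁ hw₂').trans_eq ?_),
      fun x hx a => ?_⟩
    · push_cast; ring
    rw [inner_sub_right, ← hwx₁ x hx a, ← hwx₂ x hx a]
    have hge := hθ.bddMeas_ite_le (ρ := ρ) γ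
    have hsplit : M.skipIter φ θ ρ γ π f (m + 1) = fun p => M.T π (M.skipIter φ θ ρ γ π f m) p -
        (if γ ≤ M.designRange φ θ ρ p.1 then 1 else 0) * M.T π (M.skipIter φ θ ρ γ π f m) p := by
      rw [skipIter_succ]
      ext p
      by_cases hp : γ ≤ M.designRange φ θ ρ p.1
      · simp [hp]
      · simp [hp, not_le.1 hp]
    rw [hsplit, M.iterate_T_sub π hTU (hge.mul hTU)]
    refine congrArg₂ _ rfl ?_
    rw [Function.iterate_succ_apply, Function.iterate_succ_apply (M.T π)]
    refine congrFun (congrArg _ (funext fun p => ?_)) _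
    -- The indicator depends on the state only, so it comes out of the average over actions.
    rw [T_eq _ _ (hge.mul hTU), T_eq _ _ (hge.mul (hV.comp measurable_fst))]
    refine integral_congr_ae (ae_of_all _ fun y => ?_)
    by_cases hy : γ ≤ M.designRange φ θ ρ y <;> simp [hy]

end LayeredMDP

theorem mainTheorem4 {X A : Type*} [MeasurableSpace X] [Fintype A] [MeasurableSpace A]
    [DiscreteMeasurableSpace A] (M : LayeredMDP X A) {d : ℕ}
    (φ : X → A → EuclideanSpace ℝ (Fin d))
    (θ : ℕ → Policy X A → EuclideanSpace ℝ (Fin d))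
    (hθ : M.IsLinearlyRealizable φ θ)
    (ρ : ℕ → Policy X A →₀ ℝ)
    (hρ : ∀ h ∈ Finset.Icc 1 M.H, IsApproxDesign (θ h) (ρ h) ∧
      ((ρ h).support.card : ℝ) ≤ dTilde d)
    (h ℓ : ℕ) (hh : 1 ≤ h) (hhℓ : h < ℓ) (hℓ : ℓ ≤ M.H)
    (L γ : ℝ) (hL : 0 < L) (hγ : 0 < γ)
    (f : X → ℝ) (hf : Measurable fun x : M.layer ℓ => f x)
    (hfL : ∀ x ∈ M.layer ℓ, f x ∈ Set.Icc (-L) L)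
    (π : Policy X A) :
    ∃ w : EuclideanSpace ℝ (Fin d), ‖w‖ ≤ 4 * dTilde d * (M.H : ℝ) ^ 2 * L / γ ∧
      ∀ x ∈ M.layer h, ∀ a : A,
        Integrable (M.skipStep φ θ ρ h ℓ γ f) (M.condLaw π h x a) ∧
          ∫ ω, M.skipStep φ θ ρ h ℓ γ f ω ∂(M.condLaw π h x a) = ⟪φ x a, w⟫ := by
  obtain ⟨m, rfl⟩ : ∃ m, ℓ = h + m + 1 := ⟨ℓ - h - 1, by omega⟩
  have hS : MeasurableSet (M.layer (h + m + 1)) := M.measurable_layerOf (measurableSet_singleton _)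
  -- `f` is controlled only on layer `ℓ`. Extension by zero makes it globally bounded and
  -- measurable, and changes the integrand only on a null set.
  set f' : X → ℝ := (M.layer (h + m + 1)).indicator f with hf'
  have hf'L : ∀ x, |f' x| ≤ L := by
    intro x
    by_cases hx : x ∈ M.layer (h + m + 1)
    · rw [hf', Set.indicator_of_mem hx]
      exact abs_le.2 (hfL x hx)
    · rw [hf', Set.indicator_of_notMem hx, abs_zero]
      exact hL.le
  have hf'm : BddMeas f' := by
    refine ⟨?_, L, hf'L⟩
    refine measurable_of_restrict_of_restrict_compl hS ?_ ?_
    · convert hf using 1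
      ext x
      simp [hf']
    · convert (measurable_const : Measurable fun _ : ((M.layer (h + m + 1))ᶜ : Set X) => (0 : ℝ))
        using 1
      ext x
      exact Set.indicator_of_notMem x.2 f
  obtain ⟨w, hw, hwx⟩ := hθ.exists_param_skipIter (fun j hj => (hρ j hj).2) π hγ hL hf'm hf'L m
    (h := h) (n := 0) hh (by omega)
  -- `log (log d)` may be negative; the sign is read off from the cardinality bound.
  have hd : 0 ≤ dTilde d :=
    (Nat.cast_nonneg _).trans (hρ h (Finset.mem_Icc.2 ⟨hh, by omega⟩)).2
  refine ⟨w, hw.trans ?_, fun x hx a => ?_⟩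
  · have hmH : (m : ℝ) + 1 ≤ M.H := by exact_mod_cast (by omega : m + 1 ≤ M.H)
    have hC : 0 ≤ dTilde d * (2 * M.H * L / γ) := by positivity
    calc ((m : ℝ) + 1) * (dTilde d * (2 * M.H * L / γ))
        ≤ M.H * (dTilde d * (2 * M.H * L / γ)) := mul_le_mul_of_nonneg_right hmH hC
      -- The construction gives the constant `2`; the stated `4` leaves room.
      _ ≤ 2 * (M.H * (dTilde d * (2 * M.H * L / γ))) := by
          have : 0 ≤ M.H * (dTilde d * (2 * M.H * L / γ)) := mul_nonneg (Nat.cast_nonneg _) hC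
          linarith
      _ = 4 * dTilde d * (M.H : ℝ) ^ 2 * L / γ := by ring
  · have hlt := hθ.bddMeas_ite_lt (ρ := ρ) γ
    have hge := (hθ.bddMeas_ite_le (ρ := ρ) γ).mul (hf'm.comp measurable_fst)
    have hae : M.skipStep φ θ ρ h (h + m + 1) γ f =ᵐ[M.condLaw π h x a] fun ω =>
        (∏ k ∈ Finset.Ioo h (h + m + 1), if M.designRange φ θ ρ (ω k).1 < γ then (1 : ℝ) else 0) *
          ((if γ ≤ M.designRange φ θ ρ (ω (h + m + 1)).1 then 1 else 0) *
            f' (ω (h + m + 1)).1) := by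
      filter_upwards [M.ae_condLaw_layer π (m := m + 1) (by omega) hx a] with ω hω
      rw [hf', Set.indicator_of_mem (by exact hω), LayeredMDP.skipStep]
      ring
    refine ⟨Integrable.congr (BddMeas.integrable ?_ _) hae.symm, ?_⟩
    · exact (BddMeas.prod _ fun k _ => hlt.comp (measurable_pi_apply k)).mul
        (hge.comp (measurable_pi_apply (h + m + 1)))
    · rw [integral_congr_ae hae]
      exact (M.integral_condLaw_prod_mul π hlt h m x a hge).trans (hwx x hx a)
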